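/- Let $\alpha\in(0,1)$, $N=\lfloor 1/\alpha\rfloor$ and $T>0$. Let $\mathcal X$ be a set, $\mathcal G$ a real topological vector space, $V$ a finite-dimensional real inner product space, and $\psi:\mathcal X\to C^0([0,T];\mathcal G)$. Let $\xi$ map each $x\in\mathcal X$ to an $\alpha$-Hölder rough path over $V$, i.e. a family $\xi(x)_{s,t}=(1,\xi^1(x)_{s,t},\dots,\xi^N(x)_{s,t})\in\bigoplus_{m=0}^N V^{\otimes m}$, $0\le s\le t\le T$, with Chen's relation $\xi(x)_{s,t}=\xi(x)_{s,u}\otimes\xi(x)_{u,t}$ for $s\le u\le t$ in the truncated tensor algebra and $|\xi^m(x)_{s,t}|\le C|t-s|^{m\alpha}$ for $m\le N$ (no geometricity is assumed). Let $\mathcal S=\bigcup_{s\in[0,T]}C^0([0,s];\mathcal G)$, let $K:\mathcal S\times\mathcal S\to\mathcal L(V)$ be an operator-valued kernel (that is, $K(a,b)=K(b,a)^{\top}$ and all matrices $(\langle K(a_i,a_j)y_i,y_j\rangle_V)_{i,j}$ are positive semidefinite), and let $\mathcal H_K\subseteq\{\mathcal S\to V\}$ be its reproducing kernel Hilbert space,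 so that $K(a,\cdot)y\in\mathcal H_K$ and $\langle f,K(a,\cdot)y\rangle_{\mathcal H_K}=\langle f(a),y\rangle_V$ for all $f\in\mathcal H_K$, $a\in\mathcal S$, $y\in V$. For a real Hilbert space $E$, say that $\mathbf Y=(Y^0,\dots,Y^{N-1})$ with $Y^m:[0,T]\to\mathcal L(V^{\otimes m};\mathcal L(V;E))$ is controlled by $\xi(x)$ if there is a constant $C$ such that for all $m\le N-1$ and $0\le s\le t\le T$, in operator norm, $$\Big\|Y^m_t-\sum_{j=0}^{N-1-m}Y^{m+j}_s[\xi^j(x)_{s,t}\otimes(\cdot)]\Big\|\le C|t-s|^{(N-m)\alpha},\qquad \|Y^m_t-Y^m_s\|\le C|t-s|^{\alpha};$$ it lifts a path $y:[0,T]\to\mathcal L(V;E)$ if $Y^0_t[1]=y_t$ for all $t$. Its rough integral is $$\int_0^T\mathbf Y\,d\xi(x):=\lim_{|\mathcal P|\to0}\ \sum_{[s,t]\in\mathcal P}\ \sum_{m=0}^{N-1}Y^m_s[\xi^{m+1}(x)_{s,t}]\in E,$$ the limit being taken over all finite partitions $\mathcal P$ of $[0,T]$ as the mesh $|\mathcal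 P|$ tends to $0$, where $\mathcal L(V^{\otimes m};\mathcal L(V;E))$ is included in $\mathcal L(V^{\otimes (m+1)};E)$ by $A[v\otimes z]=A[v][z]$. Fix $x\in\mathcal X$ and assume that the path $s\mapsto K(\psi(x)|_{[0,s]},\cdot)\in\mathcal L(V;\mathcal H_K)$ has a lift $\mathbf K(x)=(K^0(x),\dots,K^{N-1}(x))$ that is controlled by $\xi(x)$. Then the rough integral $$\Phi_x=\int_0^T K(\psi(x)|_{[0,t]},\cdot)\,d\xi(x)_t:=\int_0^T\mathbf K(x)\,d\xi(x)\in\mathcal H_K$$ is well defined (the limit exists in $\mathcal H_K$ and is unique). Moreover, for every $f\in\mathcal H_K$ the path $t\mapsto f(\psi(x)|_{[0,t]})\in V\simeq V^*$ is rough-integrable against $\xi(x)$: the family $\mathbf f(x)=(f^0(x),\dots,f^{N-1}(x))$, $f^m(x)_t[v][z]:=\langle f,K^m(x)_t[v][z]\rangle_{\mathcal H_K}$, lifts it and is controlled by $\xi(x)$, and its rough integral exists (with a unique limit) and satisfies $$\int_0^T\langle f(\psi(x)|_{[0,t]}),d\xi(x)_t\rangle_V:=\int_0^T\mathbf f(x)\,d\xi(x)=\langle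 f,\Phi_x\rangle_{\mathcal H_K}.$$ -/

import Mathlib

open Filter Topology
open scoped TensorProduct

noncomputable section

/-! ### Rough paths on a finite dimensional space -/

section RoughPaths

variable {V : Type*} [NormedAddCommGroup V] [InnerProductSpace ℝ V]
variable {E : Type*} [NormedAddCommGroup E] [InnerProductSpace ℝ E]

/-- The unit `1` of `V^{⊗0} = ℝ`. -/
def tensorOne (V : Type*) [NormedAddCommGroup V] [InnerProductSpace ℝ V] : ⨂[ℝ]^0 V :=
  PiTensorProduct.tprod ℝ (fun i : Fin 0 => i.elim0)

/-- The tensor product `a ⊗ b ∈ V^{⊗(i+j)}` of `a ∈ V^{⊗i}` and `b ∈ V^{⊗j}`. -/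
def tensorMul {i j : ℕ} (a : ⨂[ℝ]^i V) (b : ⨂[ℝ]^j V) : ⨂[ℝ]^(i + j) V :=
  TensorPower.mulEquiv (a ⊗ₜ[ℝ] b)

/-- The number `⌊1/α⌋` of levels of an `α`-Hölder rough path. -/
def roughDepth (α : ℝ) : ℕ := ⌊1 / α⌋₊

/-- An `α`-Hölder rough path `X_{s,t} = (1, X¹_{s,t}, …, X^N_{s,t})`, `0 ≤ s ≤ t ≤ T`, with
`N = ⌊1/α⌋`: it satisfies Chen's relation `X_{s,t} = X_{s,u} ⊗ X_{u,t}` in the truncated tensor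
algebra and `|X^n_{s,t}| ≤ C |t - s|^{nα}`.  No geometricity is required.
The values at times outside `0 ≤ s ≤ t ≤ T` and at levels `n > N` are never used.
Chen's relation is written level by level, inside the full tensor algebra. -/
structure HolderRoughPath (α T : ℝ) (V : Type*) [NormedAddCommGroup V]
    [InnerProductSpace ℝ V] where
  level : (n : ℕ) → ℝ → ℝ → ⨂[ℝ]^n V
  level_zero : ∀ s t : ℝ, 0 ≤ s → s ≤ t → t ≤ T → level 0 s t = tensorOne V
  chen : ∀ n ≤ roughDepth α, ∀ s u t : ℝ, 0 ≤ s → s ≤ u → u ≤ t → t ≤ T →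
    TensorPower.toTensorAlgebra (level n s t) =
      ∑ p ∈ Finset.HasAntidiagonal.antidiagonal n,
        TensorPower.toTensorAlgebra (level p.1 s u) * TensorPower.toTensorAlgebra (level p.2 u t)
  holder : ∃ C : ℝ, ∀ n ≤ roughDepth α, ∀ s t : ℝ, 0 ≤ s → s ≤ t → t ≤ T →
    ‖level n s t‖ ≤ C * (t - s) ^ ((n : ℝ) * α)

/-- A path with components `Y^m_t ∈ L(V^{⊗m}; L(V; E))`; only the components with `m < ⌊1/α⌋`
and the times `t ∈ [0, T]` are used. -/
abbrev TensorPath (V E : Type*) [NormedAddCommGroup V] [InnerProductSpace ℝ V]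
    [NormedAddCommGroup E] [InnerProductSpace ℝ E] : Type _ :=
  (m : ℕ) → ℝ → (⨂[ℝ]^m V →L[ℝ] V →L[ℝ] E)

/-- `Y = (Y⁰, …, Y^{N-1})`, `N = ⌊1/α⌋`, is controlled by the rough path `X`: for all `m < N`
`‖Y^m_t - ∑_{j < N-m} Y^{j+m}_s[X^j_{s,t} ⊗ ·]‖ ≤ C |t-s|^{(N-m)α}` and
`‖Y^m_t - Y^m_s‖ ≤ C |t-s|^α`.  The first operator norm bound on `V^{⊗m}` is spelled out. -/
def IsControlledBy {α T : ℝ} (X : HolderRoughPath α T V) (Y : TensorPath V E) : Prop :=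
  ∃ C : ℝ, 0 ≤ C ∧ ∀ m < roughDepth α, ∀ s t : ℝ, 0 ≤ s → s ≤ t → t ≤ T →
    (∀ v : ⨂[ℝ]^m V,
      ‖Y m t v - ∑ j ∈ Finset.range (roughDepth α - m),
          Y (j + m) s (tensorMul (X.level j s t) v)‖
        ≤ C * (t - s) ^ (((roughDepth α : ℝ) - m) * α) * ‖v‖) ∧
    ‖Y m t - Y m s‖ ≤ C * (t - s) ^ α

/-- `Y` lifts the path `y : [0,T] → L(V; E)`, i.e. `Y⁰_t[1] = y_t`. -/
def IsLiftOf {T : ℝ} (Y : TensorPath V E) (y : Set.Icc (0 : ℝ) T → (V →L[ℝ] E)) : Prop :=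
  ∀ t : Set.Icc (0 : ℝ) T, Y 0 t (tensorOne V) = y t

/-- The inclusion `L(V^{⊗m}; L(V; E)) ↪ L(V^{⊗(m+1)}; E)`,
`A ↦ (v₁ ⊗ ⋯ ⊗ v_{m+1} ↦ A[v₁ ⊗ ⋯ ⊗ v_m][v_{m+1}])`. -/
def tensorUncurry {m : ℕ} (A : ⨂[ℝ]^m V →L[ℝ] V →L[ℝ] E) : ⨂[ℝ]^(m + 1) V →ₗ[ℝ] E :=
  PiTensorProduct.lift
    (MultilinearMap.uncurryRight
      (((ContinuousLinearMap.coeLM ℝ : (V →L[ℝ] E) →ₗ[ℝ] (V →ₗ[ℝ] E)) ∘ₗ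
        A.toLinearMap).compMultilinearMap (PiTensorProduct.tprod ℝ (s := fun _ : Fin m => V))))

theorem tensorUncurry_tprod {m : ℕ} (A : ⨂[ℝ]^m V →L[ℝ] V →L[ℝ] E) (w : Fin (m + 1) → V) :
    tensorUncurry A (PiTensorProduct.tprod ℝ w) =
      A (PiTensorProduct.tprod ℝ (Fin.init w)) (w (Fin.last m)) := by
  simp [tensorUncurry]

/-- Finite partitions `0 = t₀ < t₁ < ⋯ < t_n = T` of `[0, T]`. -/
structure TimePartition (T : ℝ) where
  size : ℕ
  point : Fin (size + 1) → ℝ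
  strictMono : StrictMono point
  first : point 0 = 0
  last : point (Fin.last size) = T

/-- The mesh `max_i |t_{i+1} - t_i|` of a partition. -/
def TimePartition.mesh {T : ℝ} (P : TimePartition T) : ℝ :=
  ⨆ i : Fin P.size, (P.point i.succ - P.point i.castSucc)

/-- The compensated Riemann sum `∑_{[s,t] ∈ P} ∑_{m=0}^{N-1} Y^m_s[X^{m+1}_{s,t}]`. -/
def compensatedSum {α T : ℝ} (X : HolderRoughPath α T V) (Y : TensorPath V E)
    (P : TimePartition T) : E :=
  ∑ i : Fin P.size, ∑ m ∈ Finset.range (roughDepth α),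
    tensorUncurry (Y m (P.point i.castSucc)) (X.level (m + 1) (P.point i.castSucc) (P.point i.succ))

/-- `I` is the rough integral `∫_0^T Y dX`: the limit of the compensated Riemann sums as the
mesh of the partition tends to `0`, along all partitions of `[0, T]`. -/
def IsRoughIntegral {α T : ℝ} (X : HolderRoughPath α T V) (Y : TensorPath V E) (I : E) : Prop :=
  Tendsto (compensatedSum X Y) (comap TimePartition.mesh (𝓝 (0 : ℝ))) (𝓝 I)

/-- The pairing of an `E`-valued `Y` with `f : E`: the components are
`(v, z) ↦ ⟨f, Y^m_t[v][z]⟩`, with values in `V* = L(V; ℝ)`. -/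
def pairWith (f : E) (Y : TensorPath V E) : TensorPath V ℝ := fun m t =>
  (ContinuousLinearMap.compL ℝ V E ℝ (innerSL ℝ f)).comp (Y m t)

theorem pairWith_apply (f : E) (Y : TensorPath V E) (m : ℕ) (t : ℝ) (v : ⨂[ℝ]^m V) (z : V) :
    pairWith f Y m t v z = inner ℝ f (Y m t v z) := by
  simp [pairWith]

end RoughPaths

/-! ### Operator-valued kernels on spaces of stopped paths -/

/-- An `L(V)`-valued kernel on a set `S`: `K(x,z) = K(z,x)ᵀ`, and the matrices
`⟨K(z_i,z_j) y_i, y_j⟩` are positive semidefinite. -/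
structure OperatorKernel (S V : Type*) [NormedAddCommGroup V] [InnerProductSpace ℝ V]
    [CompleteSpace V] where
  toFun : S → S → (V →L[ℝ] V)
  symm : ∀ x z, toFun x z = ContinuousLinearMap.adjoint (toFun z x)
  posSemidef : ∀ (n : ℕ) (z : Fin n → S) (y : Fin n → V),
    (Matrix.of fun i j => (inner ℝ (toFun (z i) (z j) (y i)) (y j) : ℝ)).PosSemidef

/-- The Hilbert space of functions `H ⊆ {S → V}` is the reproducing kernel Hilbert space of `K`:
for `z : S` and `y : V` the element `K(z,·)y` of `H`, i.e. the function `w ↦ K(z,w)y`, is the one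
that represents `f ↦ ⟨f(z), y⟩`.  Here `RKHS.kerFun H z y : H` is by definition the representer,
`⟨f, RKHS.kerFun H z y⟩ = ⟨f(z), y⟩` for all `f : H`. -/
def IsRKHSOf {S V : Type*} [NormedAddCommGroup V] [InnerProductSpace ℝ V] [CompleteSpace V]
    (H : Type*) [NormedAddCommGroup H] [InnerProductSpace ℝ H] [CompleteSpace H] [RKHS ℝ H S V]
    (K : OperatorKernel S V) : Prop :=
  ∀ (z : S) (y : V) (w : S), (RKHS.kerFun H z y) w = K.toFun z w y

/-- The set `⋃_{s ∈ [0,T]} C⁰([0,s]; G)` of paths on subintervals `[0,s]`. -/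
abbrev StoppedPath (T : ℝ) (G : Type*) [TopologicalSpace G] : Type _ :=
  Σ s : Set.Icc (0 : ℝ) T, C(Set.Icc (0 : ℝ) (s : ℝ), G)

/-- The restriction `γ|_{[0,s]}` of a path `γ ∈ C⁰([0,T]; G)`. -/
def restrictPath {T : ℝ} {G : Type*} [TopologicalSpace G] (γ : C(Set.Icc (0 : ℝ) T, G))
    (s : Set.Icc (0 : ℝ) T) : StoppedPath T G :=
  ⟨s, γ.comp ⟨Set.inclusion (Set.Icc_subset_Icc_right s.2.2), continuous_inclusion _⟩⟩

end

/-! The rough integral exists because the germ `roughGerm` is almost additive of order θ = (N+1)α >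
1. By Chen's relation its defect at s ≤ u ≤ t is exactly minus the sum over m < N of the control
remainders between s and u, applied to the levels m+1 between u and t (`roughGerm_defect`). Each
term is of order (N-m)α + (m+1)α = θ, with θ > 1 because N = ⌊1/α⌋.

The sewing estimate `IsAlmostAdditive.norm_sum_sub_le` then compares Riemann sums of two partitions
through their common refinement, with an error of order δ^(θ-1) for meshes at most δ. The sums are
therefore Cauchy, and completeness gives the limit. Uniqueness holds because partitions of
arbitrarily small mesh exist.

Pairing with f is a bounded linear functional: it preserves control, commutes with compensated sums
and passes to the limit. The reproducing property enters only to identify level zero of the paired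
path with f along the stopped paths. -/

noncomputable section

/-! ### Sewing -/

section Sewing

variable {E : Type*} [NormedAddCommGroup E]

theorem exists_lt_le_and_le_succ {p : ℕ → ℝ} {c : ℝ} (n : ℕ) (hn : 0 < n) (h0 : p 0 ≤ c)
    (h1 : c ≤ p n) : ∃ i < n, p i ≤ c ∧ c ≤ p (i + 1) := by
  induction n with
  | zero => omega
  | succ n ih =>
    by_cases h : p n ≤ c
    · exact ⟨n, by omega, h, h1⟩
    · rcases Nat.eq_zero_or_pos n with rfl | hpos
      · exact absurd h0 h
      · obtain ⟨i, hi, h⟩ := ih hpos (le_of_not_ge h)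
        exact ⟨i, by omega, h⟩

/-- The constant of the sewing lemma. -/
def sewingConst (C θ : ℝ) : ℝ := 2 * C / (1 - 2 ^ (1 - θ))

theorem two_rpow_one_sub_lt_one {θ : ℝ} (hθ : 1 < θ) : (2 : ℝ) ^ (1 - θ) < 1 :=
  Real.rpow_lt_one_of_one_lt_of_neg (by norm_num) (by linarith)

theorem sewingConst_nonneg {C θ : ℝ} (hC : 0 ≤ C) (hθ : 1 < θ) : 0 ≤ sewingConst C θ :=
  div_nonneg (by linarith) (by linarith [two_rpow_one_sub_lt_one hθ])

/-- An almost additive germ `A` of order `θ > 1` on `[0, T]`. -/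
def IsAlmostAdditive (A : ℝ → ℝ → E) (T C θ : ℝ) : Prop :=
  ∀ s u t : ℝ, 0 ≤ s → s ≤ u → u ≤ t → t ≤ T → ‖A s t - A s u - A u t‖ ≤ C * (t - s) ^ θ

/-- Strong induction by halving: remove the interval that contains the midpoint. What lies on either
side has at most half the length, and reattaching the three pieces costs two defects. -/
theorem IsAlmostAdditive.norm_sum_sub_le {A : ℝ → ℝ → E} {T C θ : ℝ}
    (hA : IsAlmostAdditive A T C θ) (hC : 0 ≤ C) (hθ : 1 < θ)
    (n : ℕ) (p : ℕ → ℝ) (hp : Monotone p) (h0 : ∀ i, 0 ≤ p i) (hT : ∀ i, p i ≤ T) :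
    ‖∑ i ∈ Finset.range n, A (p i) (p (i + 1)) - A (p 0) (p n)‖ ≤
      sewingConst C θ * (p n - p 0) ^ θ := by
  induction n using Nat.strong_induction_on generalizing p with
  | _ n ih =>
  have hK := sewingConst_nonneg hC hθ
  rcases Nat.eq_zero_or_pos n with rfl | hn
  -- The degenerate triple s = u = t forces the germ to vanish on the diagonal.
  · have := hA (p 0) (p 0) (p 0) (h0 0) le_rfl le_rfl (hT 0)
    simpa [Real.zero_rpow (show θ ≠ 0 by linarith)] using this
  have hL : 0 ≤ p n - p 0 := sub_nonneg.2 (hp hn.le)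
  obtain ⟨i, hi, hi1, hi2⟩ := exists_lt_le_and_le_succ (p := p) (c := (p 0 + p n) / 2) n hn
    (by linarith) (by linarith)
  obtain ⟨k, rfl⟩ : ∃ k, n = i + 1 + k := ⟨n - (i + 1), by omega⟩
  have e1 := ih i (by omega) p hp h0 hT
  have e2 := ih k (by omega) (fun j => p (i + 1 + j)) (fun a b h => hp (by omega))
    (fun _ => h0 _) (fun _ => hT _)
  have e3 := hA (p 0) (p (i + 1)) (p (i + 1 + k)) (h0 _) (hp (by omega)) (hp (by omega)) (hT _)
  have e4 := hA (p 0) (p i) (p (i + 1)) (h0 _) (hp (by omega)) (hp (by omega)) (hT _)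
  have hθ0 : 0 ≤ θ := by linarith
  have l4 : (p (i + 1) - p 0) ^ θ ≤ (p (i + 1 + k) - p 0) ^ θ :=
    Real.rpow_le_rpow (sub_nonneg.2 (hp (by omega))) (by linarith [hp (show i + 1 ≤ i + 1 + k by omega)]) hθ0
  have l1 : (p i - p 0) ^ θ ≤ ((p (i + 1 + k) - p 0) / 2) ^ θ :=
    Real.rpow_le_rpow (sub_nonneg.2 (hp (by omega))) (by linarith) hθ0
  have l2 : (p (i + 1 + k) - p (i + 1)) ^ θ ≤ ((p (i + 1 + k) - p 0) / 2) ^ θ :=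
    Real.rpow_le_rpow (sub_nonneg.2 (hp (by omega))) (by linarith) hθ0
  simp only [add_zero] at e2
  rw [Finset.sum_range_add, Finset.sum_range_succ]
  have key : ∀ x y z a b c d : E, ‖x + y + z - a‖ ≤ ‖x - b‖ + ‖z - c‖ + ‖a - d - c‖ + ‖d - b - y‖ := by
    intro x y z a b c d
    have : x + y + z - a = (x - b) + (z - c) - (a - d - c) - (d - b - y) := by abel
    rw [this]
    refine (norm_sub_le _ _).trans (add_le_add_left ((norm_sub_le _ _).trans
      (add_le_add_left (norm_add_le _ _) _)) _)
  have hq : ((p (i + 1 + k) - p 0) / 2) ^ θ * 2 = (p (i + 1 + k) - p 0) ^ θ * 2 ^ (1 - θ) := by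
    rw [Real.div_rpow hL (by norm_num), Real.rpow_sub (by norm_num), Real.rpow_one]; ring
  -- The constant K solves K = 2^(1-θ) K + 2C, so the induction closes.
  have hKC : sewingConst C θ * (1 - 2 ^ (1 - θ)) = 2 * C :=
    div_mul_cancel₀ _ (by linarith [two_rpow_one_sub_lt_one hθ])
  refine (key _ _ _ _ _ _ _).trans ((add_le_add (add_le_add (add_le_add e1 e2) e3) e4).trans ?_)
  calc _ ≤ sewingConst C θ * ((p (i + 1 + k) - p 0) / 2) ^ θ
        + sewingConst C θ * ((p (i + 1 + k) - p 0) / 2) ^ θ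
        + C * (p (i + 1 + k) - p 0) ^ θ + C * (p (i + 1 + k) - p 0) ^ θ := by gcongr
    _ = sewingConst C θ * (((p (i + 1 + k) - p 0) / 2) ^ θ * 2)
        + 2 * C * (p (i + 1 + k) - p 0) ^ θ := by ring
    _ = _ := by rw [hq, ← hKC]; ring

theorem sum_range_sum_range_of_monotone {M : Type*} [AddCommGroup M] (f : ℕ → M) {φ : ℕ → ℕ}
    (hφ : Monotone φ) (n : ℕ) :
    ∑ i ∈ Finset.range n, ∑ j ∈ Finset.range (φ (i + 1) - φ i), f (φ i + j) =
      ∑ j ∈ Finset.range (φ n - φ 0), f (φ 0 + j) := by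
  induction n with
  | zero => simp
  | succ n ih =>
    have h1 := hφ (Nat.zero_le n)
    have h2 := hφ (Nat.le_succ n)
    rw [Finset.sum_range_succ, ih,
      show φ (n + 1) - φ 0 = (φ n - φ 0) + (φ (n + 1) - φ n) by simp only [Nat.succ_eq_add_one] at h2; omega,
      Finset.sum_range_add]
    congr 1
    refine Finset.sum_congr rfl fun j _ => ?_
    congr 1
    omega

/-- Here `r` is the refinement and `r ∘ φ` the coarse partition. A block of length L ≤ δ contributes
at most K L^θ ≤ K δ^(θ-1) L, and the lengths telescope. -/
theorem IsAlmostAdditive.norm_sum_sub_sum_le {A : ℝ → ℝ → E} {T C θ : ℝ}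
    (hA : IsAlmostAdditive A T C θ) (hC : 0 ≤ C) (hθ : 1 < θ) {δ : ℝ}
    {r : ℕ → ℝ} (hr : Monotone r) (h0 : ∀ i, 0 ≤ r i) (hT : ∀ i, r i ≤ T) {φ : ℕ → ℕ}
    (hφ : Monotone φ) (n : ℕ) (hδ : ∀ i < n, r (φ (i + 1)) - r (φ i) ≤ δ) :
    ‖∑ j ∈ Finset.range (φ n - φ 0), A (r (φ 0 + j)) (r (φ 0 + j + 1)) -
        ∑ i ∈ Finset.range n, A (r (φ i)) (r (φ (i + 1)))‖ ≤
      sewingConst C θ * δ ^ (θ - 1) * (r (φ n) - r (φ 0)) := by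
  rw [← sum_range_sum_range_of_monotone (fun j => A (r j) (r (j + 1))) hφ, ← Finset.sum_sub_distrib,
    ← Finset.sum_range_sub (fun i => r (φ i)), Finset.mul_sum]
  refine norm_sum_le_of_le _ fun i hi => ?_
  have hm := hφ (Nat.le_succ i)
  have hL : 0 ≤ r (φ (i + 1)) - r (φ i) := sub_nonneg.2 (hr hm)
  have e := hA.norm_sum_sub_le hC hθ (φ (i + 1) - φ i) (fun j => r (φ i + j))
    (fun a b h => hr (by omega)) (fun _ => h0 _) (fun _ => hT _)
  simp only [add_zero, Nat.add_sub_cancel' hm] at e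
  refine e.trans ?_
  have hK := sewingConst_nonneg hC hθ
  have hsplit : (r (φ (i + 1)) - r (φ i)) ^ θ =
      (r (φ (i + 1)) - r (φ i)) ^ (θ - 1) * (r (φ (i + 1)) - r (φ i)) := by
    conv_lhs => rw [show θ = (θ - 1) + 1 by ring]
    rw [Real.rpow_add_of_nonneg hL (by linarith) zero_le_one, Real.rpow_one]
  rw [hsplit, mul_assoc]
  have := Real.rpow_le_rpow hL (hδ i (Finset.mem_range.1 hi)) (show 0 ≤ θ - 1 by linarith)
  gcongr

/-! ### Partitions as monotone sequences -/

namespace TimePartition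

variable {T : ℝ}

/-- The points of a partition as a sequence that is eventually constant. -/
def seq (P : TimePartition T) (i : ℕ) : ℝ := P.point ⟨min i P.size, by omega⟩

theorem seq_zero (P : TimePartition T) : P.seq 0 = 0 := by
  rw [← P.first]; simp [seq]

theorem seq_size (P : TimePartition T) : P.seq P.size = T := by
  conv_rhs => rw [← P.last]
  simp [seq, Fin.last]

theorem monotone_seq (P : TimePartition T) : Monotone P.seq := fun i j h =>
  P.strictMono.monotone (by simp only [Fin.mk_le_mk]; omega)

theorem seq_castSucc (P : TimePartition T) (i : Fin P.size) : P.seq i = P.point i.castSucc := by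
  unfold seq; congr 1; ext; simp

theorem seq_succ (P : TimePartition T) (i : Fin P.size) : P.seq (i + 1) = P.point i.succ := by
  unfold seq; congr 1; ext; simp

theorem seq_succ_sub_le_mesh (P : TimePartition T) {i : ℕ} (hi : i < P.size) :
    P.seq (i + 1) - P.seq i ≤ P.mesh := by
  have h := le_ciSup (f := fun i : Fin P.size => P.point i.succ - P.point i.castSucc)
    (Set.finite_range _).bddAbove ⟨i, hi⟩
  rw [← seq_succ, ← seq_castSucc] at h
  exact h

theorem mesh_nonneg (P : TimePartition T) : 0 ≤ P.mesh :=
  Real.iSup_nonneg fun _ => sub_nonneg.2 (P.strictMono (Fin.castSucc_lt_succ)).le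

/-- The Riemann sum of a germ along a partition. -/
def germSum (P : TimePartition T) (A : ℝ → ℝ → E) : E :=
  ∑ i : Fin P.size, A (P.point i.castSucc) (P.point i.succ)

theorem germSum_eq_sum_range (P : TimePartition T) (A : ℝ → ℝ → E) :
    P.germSum A = ∑ i ∈ Finset.range P.size, A (P.seq i) (P.seq (i + 1)) := by
  rw [Finset.sum_range]
  exact Finset.sum_congr rfl fun i _ => by rw [seq_castSucc, seq_succ]

/-- The set of points of a partition. -/
def points (P : TimePartition T) : Finset ℝ := Finset.univ.image P.point

theorem seq_mem_points (P : TimePartition T) (i : ℕ) : P.seq i ∈ P.points :=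
  Finset.mem_image_of_mem _ (Finset.mem_univ _)

theorem mem_Icc_of_mem_points (P : TimePartition T) {x : ℝ} (hx : x ∈ P.points) :
    0 ≤ x ∧ x ≤ T := by
  obtain ⟨i, -, rfl⟩ := Finset.mem_image.1 hx
  exact ⟨P.first ▸ P.strictMono.monotone (Fin.zero_le i),
    (P.strictMono.monotone (Fin.le_last i)).trans P.last.le⟩

end TimePartition

/-- The increasing enumeration of a nonempty finite set of reals, eventually constant. -/
def Finset.enum (F : Finset ℝ) (hF : F.Nonempty) (i : ℕ) : ℝ :=
  F.orderEmbOfFin rfl ⟨min i (F.card - 1), by have := hF.card_pos; omega⟩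

theorem Finset.monotone_enum (F : Finset ℝ) (hF : F.Nonempty) : Monotone (F.enum hF) :=
  fun i j h => (F.orderEmbOfFin rfl).monotone (by simp only [Fin.mk_le_mk]; omega)

theorem Finset.enum_mem (F : Finset ℝ) (hF : F.Nonempty) (i : ℕ) : F.enum hF i ∈ F :=
  F.orderEmbOfFin_mem rfl _

/-- The position of a point in the increasing enumeration of a finite set. -/
def Finset.position (F : Finset ℝ) (x : F) : ℕ := (F.orderIsoOfFin rfl).symm x

theorem Finset.position_mono (F : Finset ℝ) {x y : F} (h : x ≤ y) : F.position x ≤ F.position y :=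
  (F.orderIsoOfFin rfl).symm.monotone h

theorem Finset.enum_position (F : Finset ℝ) (hF : F.Nonempty) (x : F) :
    F.enum hF (F.position x) = x := by
  have h : (⟨min (F.position x) (F.card - 1), by have := hF.card_pos; omega⟩ : Fin F.card) =
      (F.orderIsoOfFin rfl).symm x := by
    ext
    have := ((F.orderIsoOfFin rfl).symm x).2
    simp only [Finset.position]
    omega
  rw [Finset.enum, h, ← Finset.coe_orderIsoOfFin_apply, OrderIso.apply_symm_apply]

/-! ### Common refinements and convergence of Riemann sums -/

namespace TimePartition

variable {T : ℝ}

theorem norm_germSum_sub_germSum_le {A : ℝ → ℝ → E} {C θ : ℝ}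
    (hA : IsAlmostAdditive A T C θ) (hC : 0 ≤ C) (hθ : 1 < θ) {δ : ℝ} (P Q : TimePartition T)
    (hP : P.mesh ≤ δ) (hQ : Q.mesh ≤ δ) :
    ‖P.germSum A - Q.germSum A‖ ≤ 2 * (sewingConst C θ * δ ^ (θ - 1) * T) := by
  set F := P.points ∪ Q.points with hFdef
  have hF : F.Nonempty := ⟨_, Finset.mem_union_left _ (P.seq_mem_points 0)⟩
  have hI : ∀ i, 0 ≤ F.enum hF i ∧ F.enum hF i ≤ T := fun i =>
    (Finset.mem_union.1 (F.enum_mem hF i)).elim P.mem_Icc_of_mem_points Q.mem_Icc_of_mem_points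
  -- Since `R` starts at 0 and ends at T, the fine sum is the same for `P` and `Q`; this is what
  -- lets the triangle inequality join the two estimates.
  have aux : ∀ R : TimePartition T, R.mesh ≤ δ → ∀ hR : ∀ i, R.seq i ∈ F,
      ‖∑ j ∈ Finset.range (F.position ⟨R.seq R.size, hR _⟩ - F.position ⟨R.seq 0, hR _⟩),
          A (F.enum hF (F.position ⟨R.seq 0, hR _⟩ + j))
            (F.enum hF (F.position ⟨R.seq 0, hR _⟩ + j + 1)) - R.germSum A‖ ≤
        sewingConst C θ * δ ^ (θ - 1) * T := by
    intro R hRδ hR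
    have h := hA.norm_sum_sub_sum_le hC hθ (δ := δ) (F.monotone_enum hF)
      (fun i => (hI i).1) (fun i => (hI i).2) (φ := fun i => F.position ⟨R.seq i, hR i⟩)
      (fun i j hij => F.position_mono (R.monotone_seq hij)) R.size (fun i hi => by
        simp only [Finset.enum_position]
        exact (R.seq_succ_sub_le_mesh hi).trans hRδ)
    simp only [Finset.enum_position] at h
    rw [R.germSum_eq_sum_range]
    simpa only [seq_size, seq_zero, sub_zero] using h
  have h1 := aux P hP fun i => Finset.mem_union_left _ (P.seq_mem_points i)
  have h2 := aux Q hQ fun i => Finset.mem_union_right _ (Q.seq_mem_points i)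
  simp only [seq_size, seq_zero] at h1 h2
  rw [norm_sub_rev] at h1
  refine (norm_sub_le_norm_sub_add_norm_sub _ _ _).trans ((add_le_add h1 h2).trans ?_)
  linarith

/-- The partition of `[0, T]` into `n + 1` intervals of equal length. -/
def uniform (hT : 0 < T) (n : ℕ) : TimePartition T where
  size := n + 1
  point i := i * (T / (n + 1))
  strictMono i j h := by
    have : (i : ℝ) < j := by exact_mod_cast h
    exact mul_lt_mul_of_pos_right this (by positivity)
  first := by simp
  last := by simp; field_simp

theorem mesh_uniform_le (hT : 0 < T) (n : ℕ) : (uniform hT n).mesh ≤ T / (n + 1) := by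
  refine Real.iSup_le (fun i => ?_) (by positivity)
  change ((i.succ : ℕ) : ℝ) * (T / (n + 1)) - ((i.castSucc : ℕ) : ℝ) * (T / (n + 1)) ≤ _
  rw [Fin.val_succ, Fin.val_castSucc]
  push_cast
  exact le_of_eq (by ring)

theorem neBot_comap_mesh (hT : 0 < T) :
    (comap (TimePartition.mesh : TimePartition T → ℝ) (𝓝 0)).NeBot := by
  have hlim : Tendsto (fun n : ℕ => (uniform hT n).mesh) atTop (𝓝 0) := by
    refine squeeze_zero (fun n => mesh_nonneg _) (mesh_uniform_le hT) ?_
    simpa [div_eq_mul_inv] using (tendsto_one_div_add_atTop_nhds_zero_nat (𝕜 := ℝ)).const_mul T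
  have h : Tendsto (uniform hT) atTop (comap TimePartition.mesh (𝓝 0)) := tendsto_comap_iff.2 hlim
  exact h.neBot

/-- **Sewing lemma**: the Riemann sums of an almost additive germ converge. -/
theorem exists_tendsto_germSum [CompleteSpace E] (hT : 0 < T) {A : ℝ → ℝ → E} {C θ : ℝ}
    (hA : IsAlmostAdditive A T C θ) (hC : 0 ≤ C) (hθ : 1 < θ) :
    ∃ I : E, Tendsto (fun P : TimePartition T => P.germSum A)
      (comap TimePartition.mesh (𝓝 0)) (𝓝 I) := by
  have := neBot_comap_mesh hT
  refine cauchy_map_iff_exists_tendsto.1 (Metric.cauchy_iff.2 ⟨inferInstance, fun ε hε => ?_⟩)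
  have hlim : Tendsto (fun δ : ℝ => 2 * (sewingConst C θ * δ ^ (θ - 1) * T)) (𝓝 0) (𝓝 0) := by
    have h : ContinuousAt (fun δ : ℝ => 2 * (sewingConst C θ * δ ^ (θ - 1) * T)) 0 := by
      have := Real.continuousAt_rpow_const 0 (θ - 1) (Or.inr (by linarith))
      fun_prop
    have h' := h.tendsto
    rwa [Real.zero_rpow (by linarith), mul_zero, zero_mul, mul_zero] at h'
  have hev := hlim.eventually_lt_const hε
  obtain ⟨η, hη, hball⟩ := Metric.eventually_nhds_iff.1 hev
  have hsmall := hball (y := η / 2) (by simp [abs_of_pos hη]; linarith)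
  refine ⟨(fun P : TimePartition T => P.germSum A) '' {P | P.mesh ≤ η / 2},
    image_mem_map ?_, ?_⟩
  · exact (tendsto_comap.eventually_le_const (show (0 : ℝ) < η / 2 by linarith))
  · rintro _ ⟨P, hP, rfl⟩ _ ⟨Q, hQ, rfl⟩
    rw [dist_eq_norm]
    exact (norm_germSum_sub_germSum_le hA hC hθ P Q hP hQ).trans_lt hsmall

end TimePartition

end Sewing

/-! ### The germ of a controlled rough path -/

section ControlledGerm

variable {V : Type*} [NormedAddCommGroup V] [InnerProductSpace ℝ V]
variable {E : Type*} [NormedAddCommGroup E] [InnerProductSpace ℝ E]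

/-- The uncurrying `L(V^{⊗m}; L(V; E)) → L(V^{⊗(m+1)}; E)` for linear maps without continuity. -/
def tensorUncurryHom {m : ℕ} : (⨂[ℝ]^m V →ₗ[ℝ] V →ₗ[ℝ] E) →ₗ[ℝ] (⨂[ℝ]^(m + 1) V →ₗ[ℝ] E) where
  toFun A := PiTensorProduct.lift (MultilinearMap.uncurryRight
    (A.compMultilinearMap (PiTensorProduct.tprod ℝ (s := fun _ : Fin m => V))))
  map_add' A B := by ext; simp
  map_smul' c A := by ext; simp

theorem tensorUncurryHom_tprod {m : ℕ} (A : ⨂[ℝ]^m V →ₗ[ℝ] V →ₗ[ℝ] E) (w : Fin (m + 1) → V) :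
    tensorUncurryHom A (PiTensorProduct.tprod ℝ w) =
      A (PiTensorProduct.tprod ℝ (Fin.init w)) (w (Fin.last m)) := by
  simp [tensorUncurryHom]

/-- A continuous linear map into `L(V; E)` as a bilinear map. -/
def toBilin {m : ℕ} (A : ⨂[ℝ]^m V →L[ℝ] V →L[ℝ] E) : ⨂[ℝ]^m V →ₗ[ℝ] V →ₗ[ℝ] E :=
  (ContinuousLinearMap.coeLM ℝ : (V →L[ℝ] E) →ₗ[ℝ] (V →ₗ[ℝ] E)) ∘ₗ A.toLinearMap

@[simp]
theorem toBilin_apply {m : ℕ} (A : ⨂[ℝ]^m V →L[ℝ] V →L[ℝ] E) (v : ⨂[ℝ]^m V) (z : V) :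
    toBilin A v z = A v z := rfl

theorem tensorUncurry_eq {m : ℕ} (A : ⨂[ℝ]^m V →L[ℝ] V →L[ℝ] E) :
    tensorUncurry A = tensorUncurryHom (toBilin A) := rfl

/-- The norm on tensor powers is the projective one, so a bound on the underlying multilinear map
suffices. -/
theorem norm_tensorUncurryHom_le {m : ℕ} (A : ⨂[ℝ]^m V →ₗ[ℝ] V →ₗ[ℝ] E) {c : ℝ} (hc : 0 ≤ c)
    (hA : ∀ v z, ‖A v z‖ ≤ c * ‖v‖ * ‖z‖) (w : ⨂[ℝ]^(m + 1) V) :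
    ‖tensorUncurryHom A w‖ ≤ c * ‖w‖ := by
  let f : MultilinearMap ℝ (fun _ : Fin (m + 1) => V) E := MultilinearMap.uncurryRight
    (A.compMultilinearMap (PiTensorProduct.tprod ℝ (s := fun _ : Fin m => V)))
  have hf : ∀ w, ‖f w‖ ≤ c * ∏ i, ‖w i‖ := fun w => by
    rw [Fin.prod_univ_castSucc, ← mul_assoc]
    refine (hA _ _).trans ?_
    gcongr
    exact PiTensorProduct.projectiveSeminorm_tprod_le (𝕜 := ℝ) (Fin.init w)
  refine (PiTensorProduct.norm_eval_le_projectiveSeminorm (f.mkContinuous c hf) w).trans ?_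
  gcongr
  exact MultilinearMap.mkContinuous_norm_le _ hc _

/-- Left multiplication by `a ∈ V^{⊗i}`. -/
def tensorMulLeft {i : ℕ} (j : ℕ) (a : ⨂[ℝ]^i V) : ⨂[ℝ]^j V →ₗ[ℝ] ⨂[ℝ]^(i + j) V :=
  (TensorPower.mulEquiv (R := ℝ) (M := V) (n := i) (m := j)).toLinearMap ∘ₗ TensorProduct.mk ℝ _ _ a

theorem tensorMulLeft_apply {i j : ℕ} (a : ⨂[ℝ]^i V) (b : ⨂[ℝ]^j V) :
    tensorMulLeft j a b = tensorMul a b := rfl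

theorem tensorMul_add_left {i j : ℕ} (a a' : ⨂[ℝ]^i V) (b : ⨂[ℝ]^j V) :
    tensorMul (a + a') b = tensorMul a b + tensorMul a' b := by
  simp [tensorMul, TensorProduct.add_tmul]

theorem tensorMul_smul_left {i j : ℕ} (c : ℝ) (a : ⨂[ℝ]^i V) (b : ⨂[ℝ]^j V) :
    tensorMul (c • a) b = c • tensorMul a b := by
  simp only [tensorMul]
  rw [← TensorProduct.smul_tmul', map_smul]

theorem tensorMul_tprod {i j : ℕ} (a : Fin i → V) (b : Fin j → V) :
    tensorMul (PiTensorProduct.tprod ℝ a) (PiTensorProduct.tprod ℝ b) =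
      PiTensorProduct.tprod ℝ (Fin.append a b) :=
  TensorPower.tprod_mul_tprod ℝ a b

theorem toTensorAlgebra_tensorMul {i j : ℕ} (a : ⨂[ℝ]^i V) (b : ⨂[ℝ]^j V) :
    TensorPower.toTensorAlgebra (tensorMul a b) =
      TensorPower.toTensorAlgebra a * TensorPower.toTensorAlgebra b :=
  TensorPower.toTensorAlgebra_gMul a b

theorem toTensorAlgebra_tensorOne :
    TensorPower.toTensorAlgebra (tensorOne V) = (1 : TensorAlgebra ℝ V) := by
  simp [tensorOne]

/-- The right factor has positive degree, so the slot split off by uncurrying belongs to `b` and `a`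
is a mere parameter. -/
theorem tensorUncurryHom_tensorMul {i j : ℕ} (A : ⨂[ℝ]^(i + j) V →ₗ[ℝ] V →ₗ[ℝ] E)
    (a : ⨂[ℝ]^i V) (b : ⨂[ℝ]^(j + 1) V) :
    tensorUncurryHom A (tensorMul (i := i) (j := j + 1) a b) = tensorUncurryHom (A ∘ₗ tensorMulLeft j a) b := by
  suffices h : ((tensorUncurryHom A : ⨂[ℝ]^(i + (j + 1)) V →ₗ[ℝ] E) ∘ₗ
      tensorMulLeft (j + 1) a) = tensorUncurryHom (A ∘ₗ tensorMulLeft j a) from LinearMap.congr_fun h b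
  refine PiTensorProduct.ext (MultilinearMap.ext fun w => ?_)
  simp only [LinearMap.compMultilinearMap_apply, LinearMap.comp_apply, tensorUncurryHom_tprod,
    tensorMulLeft_apply]
  induction a using PiTensorProduct.induction_on with
  | smul_tprod r v =>
    simp only [tensorMul_smul_left, tensorMul_tprod, map_smul, LinearMap.smul_apply]
    congr 1
    refine (tensorUncurryHom_tprod A _).trans ?_
    congr 3
    · funext k
      refine Fin.addCases (fun k => ?_) (fun k => ?_) k
      · rw [Fin.append_left]
        exact Fin.append_left v w k
      · rw [Fin.append_right]
        exact Fin.append_right v w k.castSucc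
    · exact Fin.append_right v w (Fin.last j)
  | add x y hx hy =>
    simp only [tensorMul_add_left, map_add, LinearMap.add_apply]
    rw [← hx, ← hy]

/-! ### Chen's relation read in a single degree -/

theorem toDirectSum_toTensorAlgebra {n : ℕ} (x : ⨂[ℝ]^n V) :
    TensorAlgebra.toDirectSum (TensorPower.toTensorAlgebra x) =
      DirectSum.lof ℝ ℕ (fun n => ⨂[ℝ]^n V) n x := by
  suffices h : (TensorAlgebra.toDirectSum (R := ℝ) (M := V)).toLinearMap ∘ₗ
      TensorPower.toTensorAlgebra = DirectSum.lof ℝ ℕ (fun n => ⨂[ℝ]^n V) n from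
    LinearMap.congr_fun h x
  refine PiTensorProduct.ext (MultilinearMap.ext fun w => ?_)
  simp [-TensorAlgebra.tprod_apply, TensorAlgebra.toDirectSum_tensorPower_tprod,
    DirectSum.lof_eq_of]

/-- The component of degree `n` of an element of the tensor algebra. -/
def tensorComponent (V : Type*) [NormedAddCommGroup V] [InnerProductSpace ℝ V] (n : ℕ) :
    TensorAlgebra ℝ V →ₗ[ℝ] ⨂[ℝ]^n V :=
  DirectSum.component ℝ ℕ (fun n => ⨂[ℝ]^n V) n ∘ₗ TensorAlgebra.toDirectSum.toLinearMap

@[simp]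
theorem tensorComponent_toTensorAlgebra {n : ℕ} (x : ⨂[ℝ]^n V) :
    tensorComponent V n (TensorPower.toTensorAlgebra x) = x := by
  simp [tensorComponent, toDirectSum_toTensorAlgebra, DirectSum.component.lof_self]

theorem sum_range_sum_antidiagonal {M : Type*} [AddCommMonoid M] (N : ℕ) (f : ℕ → ℕ → M) :
    ∑ m ∈ Finset.range N, ∑ p ∈ Finset.HasAntidiagonal.antidiagonal m, f p.1 p.2 =
      ∑ j ∈ Finset.range N, ∑ i ∈ Finset.range (N - j), f i j := by
  rw [Finset.sum_sigma', Finset.sum_sigma']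
  refine Finset.sum_bij' (fun x _ => ⟨x.2.2, x.2.1⟩) (fun x _ => ⟨x.2 + x.1, (x.2, x.1)⟩)
    ?_ ?_ ?_ ?_ ?_
  · rintro ⟨m, i, j⟩ h
    simp only [Finset.mem_sigma, Finset.mem_range, Finset.HasAntidiagonal.mem_antidiagonal] at h ⊢
    omega
  · rintro ⟨j, i⟩ h
    simp only [Finset.mem_sigma, Finset.mem_range, Finset.HasAntidiagonal.mem_antidiagonal] at h ⊢
    exact ⟨by omega, trivial⟩
  · rintro ⟨m, i, j⟩ h
    simp only [Finset.mem_sigma, Finset.mem_range, Finset.HasAntidiagonal.mem_antidiagonal] at h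
    obtain ⟨_, rfl⟩ := h
    rfl
  · rintro ⟨j, i⟩ _
    rfl
  · rintro ⟨m, i, j⟩ _
    rfl

variable {α T : ℝ}

/-- The term (m+1, 0) of Chen's sum is split off by `level_zero`; in all others the right factor has
positive degree. Taking a family `B` over all degrees avoids casts between m and `p.1 + p.2`. -/
theorem HolderRoughPath.chen_tensorUncurryHom (X : HolderRoughPath α T V) {m : ℕ}
    (hm : m < roughDepth α) (B : ∀ n, ⨂[ℝ]^n V →ₗ[ℝ] V →ₗ[ℝ] E) {s u t : ℝ} (hs : 0 ≤ s)
    (hsu : s ≤ u) (hut : u ≤ t) (ht : t ≤ T) :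
    tensorUncurryHom (B m) (X.level (m + 1) s t) =
      tensorUncurryHom (B m) (X.level (m + 1) s u) +
      ∑ p ∈ Finset.HasAntidiagonal.antidiagonal m,
        tensorUncurryHom (B (p.1 + p.2) ∘ₗ tensorMulLeft p.2 (X.level p.1 s u))
          (X.level (p.2 + 1) u t) := by
  have h := congrArg (fun z => tensorUncurryHom (B m) (tensorComponent V (m + 1) z))
    (X.chen (m + 1) hm s u t hs hsu hut ht)
  simp only [tensorComponent_toTensorAlgebra] at h
  rw [h, Finset.Nat.sum_antidiagonal_succ', map_add, map_add, map_sum, map_sum]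
  congr 1
  · rw [X.level_zero u t (hs.trans hsu) hut ht, toTensorAlgebra_tensorOne, mul_one,
      tensorComponent_toTensorAlgebra]
  · refine Finset.sum_congr rfl ?_
    rintro ⟨i, j⟩ hp
    obtain rfl := Finset.HasAntidiagonal.mem_antidiagonal.1 hp
    rw [← tensorUncurryHom_tensorMul, ← toTensorAlgebra_tensorMul]
    congr 1
    exact tensorComponent_toTensorAlgebra (tensorMul (X.level i s u) (X.level (j + 1) u t))

/-- The germ `∑_{m < N} Y^m_s[X^{m+1}_{s,t}]` of the rough integral. -/
def roughGerm (X : HolderRoughPath α T V) (Y : TensorPath V E) (s t : ℝ) : E :=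
  ∑ m ∈ Finset.range (roughDepth α), tensorUncurry (Y m s) (X.level (m + 1) s t)

/-- The remainder `v ↦ Y^m_t[v] - ∑_j Y^{j+m}_s[X^j_{s,t} ⊗ v]`. -/
def controlRemainder (X : HolderRoughPath α T V) (Y : TensorPath V E) (m : ℕ) (s t : ℝ) :
    ⨂[ℝ]^m V →ₗ[ℝ] V →ₗ[ℝ] E :=
  toBilin (Y m t) - ∑ j ∈ Finset.range (roughDepth α - m),
    toBilin (Y (j + m) s) ∘ₗ tensorMulLeft m (X.level j s t)

theorem controlRemainder_apply (X : HolderRoughPath α T V) (Y : TensorPath V E) (m : ℕ) (s t : ℝ)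
    (v : ⨂[ℝ]^m V) (z : V) :
    controlRemainder X Y m s t v z = (Y m t v - ∑ j ∈ Finset.range (roughDepth α - m),
      Y (j + m) s (tensorMul (X.level j s t) v)) z := by
  simp [controlRemainder, tensorMulLeft_apply, LinearMap.sum_apply]

/-- Chen's terms range over the triangle i + j < N. Regrouped by j, they are the truncated
expansions in `controlRemainder`, with no terms left over. -/
theorem roughGerm_defect (X : HolderRoughPath α T V) (Y : TensorPath V E) {s u t : ℝ} (hs : 0 ≤ s)
    (hsu : s ≤ u) (hut : u ≤ t) (ht : t ≤ T) :
    roughGerm X Y s t - roughGerm X Y s u - roughGerm X Y u t =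
      -∑ m ∈ Finset.range (roughDepth α),
        tensorUncurryHom (controlRemainder X Y m s u) (X.level (m + 1) u t) := by
  have h1 : roughGerm X Y s t = roughGerm X Y s u +
      ∑ m ∈ Finset.range (roughDepth α), ∑ p ∈ Finset.HasAntidiagonal.antidiagonal m,
        tensorUncurryHom (toBilin (Y (p.1 + p.2) s) ∘ₗ tensorMulLeft p.2 (X.level p.1 s u))
          (X.level (p.2 + 1) u t) := by
    rw [roughGerm, roughGerm, ← Finset.sum_add_distrib]
    exact Finset.sum_congr rfl fun m hm => X.chen_tensorUncurryHom (Finset.mem_range.1 hm)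
      (fun n => toBilin (Y n s)) hs hsu hut ht
  rw [h1, sum_range_sum_antidiagonal (roughDepth α) fun i j =>
    tensorUncurryHom (toBilin (Y (i + j) s) ∘ₗ tensorMulLeft j (X.level i s u))
      (X.level (j + 1) u t)]
  simp only [controlRemainder, map_sub, map_sum, LinearMap.sub_apply, LinearMap.sum_apply,
    Finset.sum_sub_distrib]
  rw [roughGerm.eq_1 X Y u t]
  simp only [tensorUncurry_eq]
  abel

theorem one_lt_roughDepth_add_one_mul (hα : 0 < α) : 1 < ((roughDepth α : ℝ) + 1) * α := by
  have h := Nat.lt_floor_add_one (1 / α)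
  rwa [div_lt_iff₀ hα] at h

theorem IsControlledBy.exists_isAlmostAdditive {X : HolderRoughPath α T V} {Y : TensorPath V E}
    (hY : IsControlledBy X Y) (hα : 0 < α) :
    ∃ C : ℝ, 0 ≤ C ∧
      IsAlmostAdditive (roughGerm X Y) T C (((roughDepth α : ℝ) + 1) * α) := by
  obtain ⟨C, hC, hY⟩ := hY
  obtain ⟨D, hD⟩ := X.holder
  -- One summand C|D| for each m < N; the absolute value is there because `D` carries no sign.
  refine ⟨roughDepth α * (C * |D|), by positivity, fun s u t hs hsu hut ht => ?_⟩
  rw [roughGerm_defect X Y hs hsu hut ht, norm_neg]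
  have hst : 0 ≤ t - s := by linarith
  have key : ∀ m ∈ Finset.range (roughDepth α),
      ‖tensorUncurryHom (controlRemainder X Y m s u) (X.level (m + 1) u t)‖ ≤
        C * |D| * (t - s) ^ (((roughDepth α : ℝ) + 1) * α) := by
    intro m hm
    rw [Finset.mem_range] at hm
    have hm' : (m : ℝ) ≤ roughDepth α := by exact_mod_cast hm.le
    have he : 0 ≤ ((roughDepth α : ℝ) - m) * α := mul_nonneg (by linarith) hα.le
    have he' : 0 ≤ ((m + 1 : ℕ) : ℝ) * α := by positivity
    have h1 := norm_tensorUncurryHom_le (controlRemainder X Y m s u)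
      (mul_nonneg hC (Real.rpow_nonneg (sub_nonneg.2 hsu) (((roughDepth α : ℝ) - m) * α)))
      (fun v z => by
        rw [controlRemainder_apply]
        refine (ContinuousLinearMap.le_opNorm _ z).trans ?_
        gcongr
        exact (hY m hm s u hs hsu (hut.trans ht)).1 v) (X.level (m + 1) u t)
    have h2 := (hD (m + 1) hm u t (hs.trans hsu) hut ht).trans
      (mul_le_mul_of_nonneg_right (le_abs_self D) (Real.rpow_nonneg (sub_nonneg.2 hut) _))
    have h3 : (u - s) ^ (((roughDepth α : ℝ) - m) * α) ≤
        (t - s) ^ (((roughDepth α : ℝ) - m) * α) :=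
      Real.rpow_le_rpow (sub_nonneg.2 hsu) (by linarith) he
    have h4 : (t - u) ^ (((m + 1 : ℕ) : ℝ) * α) ≤ (t - s) ^ (((m + 1 : ℕ) : ℝ) * α) :=
      Real.rpow_le_rpow (sub_nonneg.2 hut) (by linarith) he'
    calc _ ≤ C * (t - s) ^ (((roughDepth α : ℝ) - m) * α) *
          (|D| * (t - s) ^ (((m + 1 : ℕ) : ℝ) * α)) := by
          refine h1.trans ?_
          gcongr
          exact h2.trans (by gcongr)
      _ = C * |D| * ((t - s) ^ (((roughDepth α : ℝ) - m) * α) *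
          (t - s) ^ (((m + 1 : ℕ) : ℝ) * α)) := by ring
      _ = _ := by
          rw [← Real.rpow_add_of_nonneg hst he he']
          congr 2
          push_cast
          ring
  refine (norm_sum_le_of_le _ key).trans (le_of_eq ?_)
  rw [Finset.sum_const, Finset.card_range, nsmul_eq_mul]
  ring

theorem isRoughIntegral_iff {X : HolderRoughPath α T V} {Y : TensorPath V E} {I : E} :
    IsRoughIntegral X Y I ↔ Tendsto (fun P : TimePartition T => P.germSum (roughGerm X Y))
      (comap TimePartition.mesh (𝓝 0)) (𝓝 I) := Iff.rfl

/-- The rough integral of a controlled path exists. -/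
theorem IsControlledBy.exists_isRoughIntegral [CompleteSpace E] {X : HolderRoughPath α T V}
    {Y : TensorPath V E} (hY : IsControlledBy X Y) (hα : 0 < α) (hT : 0 < T) :
    ∃ I : E, IsRoughIntegral X Y I := by
  obtain ⟨C, hC, hA⟩ := hY.exists_isAlmostAdditive hα
  obtain ⟨I, hI⟩ :=
    TimePartition.exists_tendsto_germSum hT hA hC (one_lt_roughDepth_add_one_mul hα)
  exact ⟨I, isRoughIntegral_iff.2 hI⟩

theorem IsRoughIntegral.unique {X : HolderRoughPath α T V} {Y : TensorPath V E} {I I' : E}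
    (hT : 0 < T) (h : IsRoughIntegral X Y I) (h' : IsRoughIntegral X Y I') : I = I' :=
  have := TimePartition.neBot_comap_mesh hT
  tendsto_nhds_unique h h'

/-! ### Pairing with a vector -/

theorem norm_innerSL_comp_le (f : E) (A : V →L[ℝ] E) :
    ‖(innerSL ℝ f).comp A‖ ≤ ‖f‖ * ‖A‖ :=
  (ContinuousLinearMap.opNorm_comp_le _ _).trans_eq (by rw [innerSL_apply_norm])

theorem IsControlledBy.pairWith {X : HolderRoughPath α T V} {Y : TensorPath V E}
    (hY : IsControlledBy X Y) (f : E) : IsControlledBy X (pairWith f Y) := by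
  obtain ⟨C, hC, hY⟩ := hY
  refine ⟨‖f‖ * C, by positivity, fun m hm s t hs hst ht => ⟨fun v => ?_, ?_⟩⟩
  · have h : _root_.pairWith f Y m t v - ∑ j ∈ Finset.range (roughDepth α - m),
          _root_.pairWith f Y (j + m) s (tensorMul (X.level j s t) v) =
        (innerSL ℝ f).comp (Y m t v - ∑ j ∈ Finset.range (roughDepth α - m),
          Y (j + m) s (tensorMul (X.level j s t) v)) := by
      ext z
      simp [pairWith_apply]
    rw [h]
    refine (norm_innerSL_comp_le _ _).trans ?_
    rw [mul_assoc, mul_assoc, ← mul_assoc C]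
    gcongr
    exact (hY m hm s t hs hst ht).1 v
  · rw [mul_assoc]
    -- Nonnegativity of C(t-s)^α is read off from the norm it dominates.
    refine ContinuousLinearMap.opNorm_le_bound _ (mul_nonneg (norm_nonneg f)
      ((norm_nonneg (Y m t - Y m s)).trans (hY m hm s t hs hst ht).2)) fun v => ?_
    have h : (_root_.pairWith f Y m t - _root_.pairWith f Y m s) v =
        (innerSL ℝ f).comp ((Y m t - Y m s) v) := by
      ext z
      simp [pairWith_apply]
    rw [h]
    refine (norm_innerSL_comp_le _ _).trans ?_
    rw [mul_assoc]
    gcongr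
    exact (ContinuousLinearMap.le_opNorm _ v).trans
      (mul_le_mul_of_nonneg_right (hY m hm s t hs hst ht).2 (norm_nonneg v))

theorem tensorUncurry_pairWith (f : E) (Y : TensorPath V E) (m : ℕ) (t : ℝ)
    (w : ⨂[ℝ]^(m + 1) V) :
    tensorUncurry (pairWith f Y m t) w = inner ℝ f (tensorUncurry (Y m t) w) := by
  suffices h : tensorUncurry (pairWith f Y m t) =
      (innerSL ℝ f).toLinearMap ∘ₗ tensorUncurry (Y m t) from LinearMap.congr_fun h w
  refine PiTensorProduct.ext (MultilinearMap.ext fun w => ?_)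
  simp [tensorUncurry_tprod, pairWith_apply]

theorem compensatedSum_pairWith (X : HolderRoughPath α T V) (f : E) (Y : TensorPath V E)
    (P : TimePartition T) :
    compensatedSum X (pairWith f Y) P = inner ℝ f (compensatedSum X Y P) := by
  simp only [compensatedSum, tensorUncurry_pairWith, inner_sum]

theorem IsRoughIntegral.pairWith {X : HolderRoughPath α T V} {Y : TensorPath V E} {I : E}
    (h : IsRoughIntegral X Y I) (f : E) :
    IsRoughIntegral X (pairWith f Y) (inner ℝ f I) :=
  (Tendsto.inner tendsto_const_nhds h).congr fun P => (compensatedSum_pairWith X f Y P).symm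

end ControlledGerm

end

theorem mainTheorem3
    (α : ℝ) (hα0 : 0 < α) (hα1 : α < 1) (T : ℝ) (hT : 0 < T)
    (𝒳 : Type*)
    (G : Type*) [AddCommGroup G] [Module ℝ G] [TopologicalSpace G] [IsTopologicalAddGroup G]
    [ContinuousSMul ℝ G]
    (V : Type*) [NormedAddCommGroup V] [InnerProductSpace ℝ V] [FiniteDimensional ℝ V]
    [CompleteSpace V]
    (ψ : 𝒳 → C(Set.Icc (0 : ℝ) T, G))
    (ξ : 𝒳 → HolderRoughPath α T V)
    (K : OperatorKernel (StoppedPath T G) V)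
    (H : Type*) [NormedAddCommGroup H] [InnerProductSpace ℝ H] [CompleteSpace H]
    [RKHS ℝ H (StoppedPath T G) V] (hH : IsRKHSOf H K)
    (x : 𝒳)
    (Kx : TensorPath V H)
    (hlift : IsLiftOf Kx (fun s : Set.Icc (0 : ℝ) T => RKHS.kerFun H (restrictPath (ψ x) s)))
    (hctrl : IsControlledBy (ξ x) Kx) :
    ∃ Φ : H,
      IsRoughIntegral (ξ x) Kx Φ ∧
      (∀ Φ' : H, IsRoughIntegral (ξ x) Kx Φ' → Φ' = Φ) ∧
      ∀ f : H,
        IsLiftOf (pairWith f Kx)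
          (fun t : Set.Icc (0 : ℝ) T => innerSL ℝ (f (restrictPath (ψ x) t))) ∧
        IsControlledBy (ξ x) (pairWith f Kx) ∧
        IsRoughIntegral (ξ x) (pairWith f Kx) (inner ℝ f Φ) ∧
        (∀ I : ℝ, IsRoughIntegral (ξ x) (pairWith f Kx) I → I = inner ℝ f Φ) := by
  obtain ⟨Φ, hΦ⟩ := hctrl.exists_isRoughIntegral hα0 hT
  refine ⟨Φ, hΦ, fun Φ' h => h.unique hT hΦ, fun f => ⟨fun t => ?_, hctrl.pairWith f,
    hΦ.pairWith f, fun I h => h.unique hT (hΦ.pairWith f)⟩⟩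
  ext z
  -- The reproducing property: pairing f with the kernel section in direction z gives ⟨f(·), z⟩ at
  -- the stopped path.
  rw [pairWith_apply, hlift t, RKHS.inner_kerFun, innerSL_apply_apply]
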